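/- Let $\xi_0,\xi_1,\dots$ be complex-valued i.i.d. random variables on a probability space $(\Omega,\mathcal F,\mathbb P)$ that are non-degenerate (not a.s. constant) and satisfy $\mathbb E\log(1+|\xi_0|)<\infty$. Let $f_{k,n}\in\mathbb C$ ($k\in\mathbb N_0$, $n\in\mathbb N$) be deterministic coefficients, and suppose that there are a function $f:[0,\infty)\to[0,\infty)$ and $T_0\in(0,\infty]$ such that (A1) $f(t)>0$ for $t<T_0$ and $f(t)=0$ for $t>T_0$; (A2) $f$ is continuous on $[0,T_0)$ and, if $T_0<\infty$, left continuous at $T_0$; (A3) $\lim_{n\to\infty}\sup_{k\in\mathbb N_0,\,k\le An}\bigl||f_{k,n}|^{1/n}-f(k/n)\bigr|=0$ for every $A>0$; (A4) $R_0:=\liminf_{t\to\infty}f(t)^{-1/t}\in(0,\infty]$ and $\liminf_{n,\,k/n\to\infty}|f_{k,n}|^{-1/k}\ge R_0$ (the lower limit is taken as $n\to\infty$ and $k/n\to\infty$ simultaneously, and a negative power of $0$ is $+\infty$). Write $\mathbf G_n(z)=\sum_{k=0}^\infty\xi_kf_{k,n}z^k$ and $I(s)=\sup_{t\ge0}\bigl(st+\log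 f(t)\bigr)$, where $\log 0=-\infty$. Then for every $z\in\mathbb C$ with $0<|z|<R_0$: 1. for all sufficiently large $n$ (depending on $z$), the series defining $\mathbf G_n(z)$ converges (absolutely) with probability $1$, and $I(\log|z|)$ is finite; 2. $\frac1n\log|\mathbf G_n(z)|\to I(\log|z|)$ in probability as $n\to\infty$ (where $\log 0=-\infty$); 3. for every $\varepsilon>0$, $$\mathbb P\left[|\mathbf G_n(z)|<e^{n(I(\log|z|)-\varepsilon)}\right]=O\left(n^{-1/2}\right),\qquad n\to\infty.$$ -/

import Mathlib

open MeasureTheory ProbabilityTheory Filter Topology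
open scoped NNReal ENNReal

noncomputable section

namespace RandomTaylor

/-- `R₀ = liminf_{t → ∞} f(t)^{-1/t}`, as an element of `[0, ∞]`
(so `0 ^ (-1/t) = ∞`, the convention of `ℝ≥0∞`). -/
def radius (f : ℝ≥0 → ℝ≥0) : ℝ≥0∞ :=
  liminf (fun t : ℝ≥0 => (f t : ℝ≥0∞) ^ (-(1 / (t : ℝ)))) atTop

/-- The filter on pairs `(k, n)` describing `n → ∞` and `k / n → ∞` simultaneously. -/
def jointAtTop : Filter (ℕ × ℕ) :=
  comap (fun p : ℕ × ℕ => ((p.2 : ℝ), (p.1 : ℝ) / (p.2 : ℝ))) (atTop ×ˢ atTop)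

/-- The standing assumptions on the deterministic coefficients `F k n` (that is, `f_{k,n}`),
the limit profile `f` and the number `T₀ ∈ (0, ∞]`. -/
structure Assumptions (F : ℕ → ℕ → ℂ) (f : ℝ≥0 → ℝ≥0) (T₀ : ℝ≥0∞) : Prop where
  T₀_pos : 0 < T₀
  a1_pos : ∀ t : ℝ≥0, (t : ℝ≥0∞) < T₀ → 0 < f t
  a1_zero : ∀ t : ℝ≥0, T₀ < (t : ℝ≥0∞) → f t = 0
  a2_cont : ContinuousOn f {t : ℝ≥0 | (t : ℝ≥0∞) < T₀}
  a2_left : ∀ T : ℝ≥0, T₀ = (T : ℝ≥0∞) → ContinuousWithinAt f (Set.Iic T) T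
  /-- The supremum over integers `0 ≤ k ≤ A n` of `| |f_{k,n}|^{1/n} - f(k/n) |` tends to `0`. -/
  a3 : ∀ A : ℝ, 0 < A → ∀ ε : ℝ, 0 < ε → ∀ᶠ n : ℕ in atTop, ∀ k : ℕ, (k : ℝ) ≤ A * (n : ℝ) →
    |‖F k n‖ ^ (1 / (n : ℝ)) - (f ((k : ℝ≥0) / (n : ℝ≥0)) : ℝ)| ≤ ε
  a4_pos : 0 < radius f
  a4_liminf : radius f ≤
    liminf (fun p : ℕ × ℕ => ‖F p.1 p.2‖ₑ ^ (-(1 / (p.1 : ℝ)))) jointAtTop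

/-- The Legendre-Fenchel transform `I(s) = sup_{t ≥ 0} (s t + log f(t))` of `-log f`,
with `log 0 = -∞`. -/
def legendreI (f : ℝ≥0 → ℝ≥0) (s : ℝ) : EReal :=
  ⨆ t : ℝ≥0, (((s * (t : ℝ) : ℝ) : EReal) + ENNReal.log (f t : ℝ≥0∞))

/-- The value at `z` of the random Taylor series `∑ ξ_k f_{k,n} z^k`. -/
def series {Ω : Type*} (ξ : ℕ → Ω → ℂ) (F : ℕ → ℕ → ℂ) (n : ℕ) (z : ℂ) (ω : Ω) : ℂ :=
  ∑' k : ℕ, ξ k ω * F k n * z ^ k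

/-- `p_n(z) = (1/n) log |G_n(z)|`, with `log 0 = -∞`. -/
def logPotential {Ω : Type*} (ξ : ℕ → Ω → ℂ) (F : ℕ → ℕ → ℂ) (n : ℕ) (z : ℂ) (ω : Ω) : EReal :=
  ((1 / (n : ℝ) : ℝ) : EReal) * ENNReal.log ‖series ξ F n z ω‖ₑ

/-- Convergence in probability of extended real random variables to a real constant `c`:
for every `ε > 0`, the probability that `|X_n - c| > ε` (in particular, that `X_n = ±∞`)
tends to `0`. -/
def TendstoInProbability {Ω : Type*} [MeasurableSpace Ω] (P : Measure Ω)
    (X : ℕ → Ω → EReal) (c : ℝ) : Prop :=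
  ∀ ε : ℝ, 0 < ε →
    Tendsto (fun n : ℕ =>
        P {ω | ¬ (((c - ε : ℝ) : EReal) ≤ X n ω ∧ X n ω ≤ ((c + ε : ℝ) : EReal))})
      atTop (𝓝 0)

end RandomTaylor

end

/-! Put `W = ‖z‖` and `c = I(log W)`. On the exponential scale `|f_{k,n}| W^k` is `(f(t) W^t)^n`
with `t = k/n`, and `e^c` is the supremum of `f(t) W^t`, so the largest terms of the series have
size about `e^{nc}`.

Upper bound: the log moment makes `|ξ_k| ≤ e^{δ(k+n)}` hold for all `k` at once with probability
tending to 1. Since `W` is below the radius, the coefficients satisfy `|f_{k,n}| W^k ≤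
e^{n(c+ε)-2δk}` (`exists_eventually_coeff_mul_pow_le`), and a geometric series remains.

Lower bound: by one-sided continuity, `f(t) W^t` is nearly `e^c` on a whole interval of `t`, so
order `n` of the weights exceed `e^{n(c-ε/2)}`. A sum of independent non-degenerate variables with
that many large weights lies in a much smaller disc with probability `O(n^{-1/2})`. This
concentration bound (`pi_real_norm_sum_lt_le`) follows by symmetrization: draw a pair at each index,
choose one entry of each pair by a fair coin, and apply Littlewood–Offord to the coins. It rests on
Sperner's theorem. -/

namespace RandomTaylor

/-! ### Littlewood–Offord inequalities. -/

theorem centralBinom_sq_mul_le (n : ℕ) : n.centralBinom ^ 2 * (2 * n + 1) ≤ 4 ^ (2 * n) := by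
  induction n with
  | zero => simp
  | succ n ih =>
    have h := Nat.succ_mul_centralBinom_succ n
    refine Nat.le_of_mul_le_mul_left (c := (n + 1) ^ 2) ?_ (by positivity)
    calc (n + 1) ^ 2 * ((n + 1).centralBinom ^ 2 * (2 * (n + 1) + 1))
        = ((n + 1) * (n + 1).centralBinom) ^ 2 * (2 * n + 3) := by ring
      _ = 4 * ((2 * n + 1) * (2 * n + 3)) * (n.centralBinom ^ 2 * (2 * n + 1)) := by
          rw [h]; ring
      _ ≤ 4 * (4 * (n + 1) ^ 2) * 4 ^ (2 * n) := by
          gcongr 4 * ?_ * ?_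
          · nlinarith
      _ = (n + 1) ^ 2 * 4 ^ (2 * (n + 1)) := by ring

theorem choose_half_sq_mul_le (m : ℕ) : m.choose (m / 2) ^ 2 * (m + 1) ≤ 4 ^ m := by
  obtain ⟨n, rfl | rfl⟩ := m.even_or_odd'
  · rw [Nat.mul_div_cancel_left _ two_pos, ← Nat.centralBinom_eq_two_mul_choose]
    exact centralBinom_sq_mul_le n
  · have h1 : (2 * n + 1) / 2 = n := by omega
    have h2 : (n + 1).centralBinom = 2 * (2 * n + 1).choose n := by
      rw [Nat.centralBinom_eq_two_mul_choose, show 2 * (n + 1) = (2 * n + 1) + 1 by ring,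
        Nat.choose_succ_succ, ← Nat.choose_symm_half n]
      ring
    have h3 := centralBinom_sq_mul_le (n + 1)
    rw [h1]
    rw [h2] at h3
    have h4 : (4 : ℕ) ^ (2 * (n + 1)) = 4 * 4 ^ (2 * n + 1) := by ring
    rw [h4] at h3
    nlinarith [sq_nonneg ((2 * n + 1).choose n)]

theorem choose_half_le (m : ℕ) : (m.choose (m / 2) : ℝ) ≤ 2 ^ m * (1 / √((m : ℝ) + 1)) := by
  rw [mul_one_div, le_div_iff₀ (by positivity)]
  refine le_of_sq_le_sq ?_ (by positivity)
  rw [mul_pow, Real.sq_sqrt (by positivity), ← pow_mul, mul_comm m 2, pow_mul]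
  norm_num
  exact_mod_cast choose_half_sq_mul_le m

/-- Erdős' form of the Littlewood–Offord inequality. -/
theorem card_abs_sum_lt_le {α : Type*} [Fintype α] [DecidableEq α] (v : α → ℝ) {r : ℝ}
    (hv : ∀ i, 2 * r ≤ |v i|) (c : ℝ) :
    (Finset.univ.filter fun e : Finset α => |c + ∑ i ∈ e, v i| < r).card ≤
      (Fintype.card α).choose (Fintype.card α / 2) := by
  -- Toggling membership on the negative indices permutes the subsets and replaces every `v i` by
  -- `|v i|`, at the cost of a new offset `c'`.
  set N : Finset α := Finset.univ.filter fun i => v i < 0 with hN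
  set c' : ℝ := c + ∑ i ∈ N, v i with hc'
  have hsum (e : Finset α) : c + ∑ i ∈ e, v i = c' + ∑ i ∈ symmDiff e N, |v i| := by
    rw [hc', add_assoc, add_right_inj]
    have h (s : Finset α) (w : α → ℝ) : ∑ i ∈ s, w i = ∑ i, if i ∈ s then w i else 0 := by simp
    rw [h e, h N, h (symmDiff e N), ← Finset.sum_add_distrib]
    refine Finset.sum_congr rfl fun i _ => ?_
    by_cases hi : v i < 0
    · have : i ∈ N := by simp [hN, hi]
      by_cases he : i ∈ e <;> simp [Finset.mem_symmDiff, this, he, abs_of_neg hi]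
    · have : i ∉ N := by simpa [hN] using hi
      by_cases he : i ∈ e <;> simp [Finset.mem_symmDiff, this, he, abs_of_nonneg (not_lt.1 hi)]
  refine le_trans ?_ (IsAntichain.sperner
    (𝒜 := Finset.univ.filter fun e : Finset α => |c' + ∑ i ∈ e, (|v i|)| < r) ?_)
  · refine Finset.card_le_card_of_injOn (fun e => symmDiff e N) (fun e he => ?_)
      (fun a _ b _ hab => symmDiff_left_injective N hab)
    simp only [Finset.coe_filter, Finset.mem_univ, true_and, Set.mem_ofPred_eq] at he ⊢
    rwa [← hsum]
  -- With nonnegative summands, a strictly larger subset raises the sum by at least `2 * r`, the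
  -- length of the open target interval; so the family is an antichain.
  · intro a ha b hb hab hle
    simp only [Finset.coe_filter, Finset.mem_univ, true_and, Set.mem_ofPred_eq] at ha hb
    obtain ⟨i, hib, hia⟩ := Finset.exists_of_ssubset (hle.ssubset_of_ne hab)
    have h1 : |v i| ≤ ∑ j ∈ b \ a, |v j| :=
      Finset.single_le_sum (f := fun j => |v j|) (fun j _ => abs_nonneg _)
        (Finset.mem_sdiff.2 ⟨hib, hia⟩)
    have h2 := Finset.sum_sdiff (f := fun j => |v j|) hle
    have h3 := hv i
    rw [abs_lt] at ha hb
    linarith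

theorem card_abs_sum_lt_le_of_subset {ι : Type*} [Fintype ι] [DecidableEq ι] (v : ι → ℝ) {r : ℝ}
    (M : Finset ι) (hv : ∀ i ∈ M, 2 * r ≤ |v i|) (c : ℝ) :
    ((Finset.univ.filter fun e : Finset ι => |c + ∑ i ∈ e, v i| < r).card : ℝ) ≤
      2 ^ Fintype.card ι * (1 / √((M.card : ℝ) + 1)) := by
  set S := Finset.univ.filter fun e : Finset ι => |c + ∑ i ∈ e, v i| < r with hS
  have key : S.card ≤ M.card.choose (M.card / 2) * (Mᶜ.powerset).card := by
    -- Fix the part of `e` outside `M`: it only shifts the offset, and each fibre is a problem on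
    -- `M` alone.
    refine Finset.card_le_mul_card_image_of_maps_to (f := fun e => e \ M)
      (fun e _ => by
        rw [Finset.mem_powerset]
        intro x hx
        simpa using (Finset.mem_sdiff.1 hx).2) _ fun b _ => ?_
    have hB := card_abs_sum_lt_le (α := M) (fun i => v i) (fun i => hv i i.2)
      (c + ∑ i ∈ b, v i)
    rw [Fintype.card_coe] at hB
    refine le_trans (Finset.card_le_card_of_injOn (fun e => e.subtype (· ∈ M)) ?_ ?_) hB
    · intro e he
      simp only [Finset.coe_filter, hS, Finset.mem_filter, Finset.mem_univ, true_and,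
        Set.mem_ofPred_eq] at he ⊢
      obtain ⟨he, rfl⟩ := he
      rw [Finset.sum_subtype_eq_sum_filter, Finset.filter_mem_eq_inter, add_assoc,
        add_comm (∑ i ∈ e \ M, v i), Finset.sum_inter_add_sum_sdiff]
      exact he
    · intro e he e' he' hee
      simp only [Finset.coe_filter, Set.mem_ofPred_eq] at he he'
      have h1 : e \ M = e' \ M := he.2.trans he'.2.symm
      have h2 : e ∩ M = e' ∩ M := by
        ext x
        by_cases hx : x ∈ M
        · have := congrArg (fun s => (⟨x, hx⟩ : M) ∈ s) hee
          simpa [hx] using this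
        · simp [hx]
      rw [← Finset.sdiff_union_inter e M, h1, h2, Finset.sdiff_union_inter]
  rw [Finset.card_powerset, Finset.card_compl] at key
  calc (S.card : ℝ) ≤ (M.card.choose (M.card / 2) : ℝ) * 2 ^ (Fintype.card ι - M.card) := by
        exact_mod_cast key
    _ ≤ 2 ^ M.card * (1 / √((M.card : ℝ) + 1)) * 2 ^ (Fintype.card ι - M.card) := by
        gcongr
        exact choose_half_le _
    _ = 2 ^ (M.card + (Fintype.card ι - M.card)) * (1 / √((M.card : ℝ) + 1)) := by
        rw [pow_add]; ring
    _ = _ := by rw [Nat.add_sub_cancel' (Finset.card_le_univ M)]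

/-- The complex Littlewood–Offord inequality. -/
theorem card_norm_sum_lt_le {ι : Type*} [Fintype ι] [DecidableEq ι] (v : ι → ℂ) {r : ℝ}
    (M : Finset ι) (hv : ∀ i ∈ M, 4 * r ≤ ‖v i‖) (c : ℂ) :
    ((Finset.univ.filter fun e : Finset ι => ‖c + ∑ i ∈ e, v i‖ < r).card : ℝ) ≤
      2 ^ Fintype.card ι * (2 / √((M.card : ℝ) + 1)) := by
  -- A vector of norm at least `4 * r` has a coordinate of size at least `2 * r`, so one of the two
  -- coordinates is large on at least half of `M`.
  set M₁ := M.filter fun i => 2 * r ≤ |(v i).re| with hM₁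
  set M₂ := M.filter fun i => 2 * r ≤ |(v i).im| with hM₂
  have hcard : M.card ≤ M₁.card + M₂.card := by
    refine le_trans (Finset.card_le_card ?_) (Finset.card_union_le M₁ M₂)
    intro i hi
    have h1 := hv i hi
    have h2 := Complex.norm_le_abs_re_add_abs_im (v i)
    simp only [hM₁, hM₂, Finset.mem_union, Finset.mem_filter, hi, true_and]
    by_contra! h
    linarith
  have hfin (m : ℕ) (h : M.card ≤ 2 * m) : 1 / √((m : ℝ) + 1) ≤ 2 / √((M.card : ℝ) + 1) := by
    rw [div_le_div_iff₀ (by positivity) (by positivity), one_mul]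
    refine Real.sqrt_le_iff.2 ⟨by positivity, ?_⟩
    rw [mul_pow, Real.sq_sqrt (by positivity)]
    have : (M.card : ℝ) ≤ 2 * m := by exact_mod_cast h
    have hm : (0 : ℝ) ≤ m := by positivity
    linarith
  have hmain (w : ι → ℝ) (b : ℝ) (m : Finset ι) (h : M.card ≤ 2 * m.card)
      (hw : ∀ i ∈ m, 2 * r ≤ |w i|)
      (hle : ∀ e : Finset ι, |b + ∑ i ∈ e, w i| ≤ ‖c + ∑ i ∈ e, v i‖) :
      ((Finset.univ.filter fun e : Finset ι => ‖c + ∑ i ∈ e, v i‖ < r).card : ℝ) ≤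
        2 ^ Fintype.card ι * (2 / √((M.card : ℝ) + 1)) := by
    calc ((Finset.univ.filter fun e : Finset ι => ‖c + ∑ i ∈ e, v i‖ < r).card : ℝ)
        ≤ (Finset.univ.filter fun e : Finset ι => |b + ∑ i ∈ e, w i| < r).card := by
          exact_mod_cast Finset.card_le_card
            (Finset.monotone_filter_right _ fun e _ he => (hle e).trans_lt he)
      _ ≤ 2 ^ Fintype.card ι * (1 / √((m.card : ℝ) + 1)) :=
          card_abs_sum_lt_le_of_subset w m hw b
      _ ≤ _ := by
          exact mul_le_mul_of_nonneg_left (hfin _ h) (by positivity)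
  rcases le_total M₁.card M₂.card with h | h
  · refine hmain (fun i => (v i).im) c.im M₂ (by omega) (fun i hi => (Finset.mem_filter.1 hi).2)
      fun e => ?_
    rw [← Complex.im_sum, ← Complex.add_im]
    exact Complex.abs_im_le_norm _
  · refine hmain (fun i => (v i).re) c.re M₁ (by omega) (fun i hi => (Finset.mem_filter.1 hi).2)
      fun e => ?_
    rw [← Complex.re_sum, ← Complex.add_re]
    exact Complex.abs_re_le_norm _

/-! ### Concentration of weighted sums of i.i.d. variables. -/

theorem exp_neg_le_one_div_sqrt {x : ℝ} (hx : 0 < x) : Real.exp (-x) ≤ 1 / √x := by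
  rw [Real.exp_neg, ← one_div]
  refine one_div_le_one_div_of_le (Real.sqrt_pos.2 hx) ?_
  have h1 := Real.add_one_le_exp x
  have h2 := Real.sq_sqrt hx.le
  nlinarith [sq_nonneg (√x - 1)]

/-- The constant governing the concentration of weighted sums of independent variables of law
`μ`. -/
noncomputable def spread (μ : Measure ℂ) (η : ℝ) : ℝ :=
  (μ.prod μ).real {q | η ≤ ‖q.1 - q.2‖} * (1 - Real.exp (-1)) / 2

/-- Choose the first component of `q k` for `k ∈ e`, and the second one otherwise. -/
def select {ι : Type*} [DecidableEq ι] (e : Finset ι) (q : ι → ℂ × ℂ) (k : ι) : ℂ :=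
  if k ∈ e then (q k).1 else (q k).2

theorem measurePreserving_select {ι : Type*} [Fintype ι] [DecidableEq ι] (μ : Measure ℂ)
    [IsProbabilityMeasure μ] (e : Finset ι) :
    MeasurePreserving (select e) (Measure.pi fun _ : ι => μ.prod μ) (Measure.pi fun _ => μ) := by
  refine measurePreserving_pi (f := fun k (q : ℂ × ℂ) => if k ∈ e then q.1 else q.2) _ _ fun k => ?_
  by_cases hk : k ∈ e
  · simpa [hk] using measurePreserving_fst (μ := μ) (ν := μ)
  · simpa [hk] using measurePreserving_snd (μ := μ) (ν := μ)

/-- For fixed pairs `q` this is a subset sum with an offset, the form that Littlewood–Offord handles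
as `e` varies. -/
theorem sum_mul_select {ι : Type*} [Fintype ι] [DecidableEq ι] (a : ι → ℂ) (e : Finset ι)
    (q : ι → ℂ × ℂ) :
    ∑ k, a k * select e q k = ∑ k, a k * (q k).2 + ∑ k ∈ e, a k * ((q k).1 - (q k).2) := by
  rw [← Finset.sum_filter_add_sum_filter_not Finset.univ (· ∈ e) fun k => a k * (q k).2]
  rw [← Finset.sum_filter_add_sum_filter_not Finset.univ (· ∈ e) fun k => a k * select e q k]
  have h1 : ∑ k with k ∉ e, a k * select e q k = ∑ k with k ∉ e, a k * (q k).2 :=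
    Finset.sum_congr rfl fun k hk => by simp [select, (Finset.mem_filter.1 hk).2]
  have h2 : ∑ k ∈ e, a k * select e q k = ∑ k ∈ e, a k * (q k).1 :=
    Finset.sum_congr rfl fun k hk => by simp [select, hk]
  rw [h1]
  simp only [Finset.filter_univ_mem, h2, mul_sub, Finset.sum_sub_distrib]
  ring

/-- Weight `exp (-1)` for the good pairs at the sites of `J`, and `1` otherwise. -/
noncomputable def penalty {ι : Type*} [DecidableEq ι] (J : Finset ι) (η : ℝ) (k : ι)
    (q : ℂ × ℂ) : ℝ :=
  if k ∈ J then 1 - {q : ℂ × ℂ | η ≤ ‖q.1 - q.2‖}.indicator (fun _ => 1 - Real.exp (-1)) q else 1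

theorem measurableSet_separated (η : ℝ) : MeasurableSet {q : ℂ × ℂ | η ≤ ‖q.1 - q.2‖} :=
  measurableSet_le measurable_const (by fun_prop)

/-- At a site of `J` the integral is exactly `1 - 2 * spread μ η`, which explains the factor `(1 -
exp (-1)) / 2` in `spread`; then `1 - x ≤ exp (-x)`. -/
theorem integral_penalty_le {ι : Type*} [DecidableEq ι] (μ : Measure ℂ)
    [IsProbabilityMeasure μ] (J : Finset ι) (η : ℝ) (k : ι) :
    ∫ q, penalty J η k q ∂(μ.prod μ) ≤ if k ∈ J then Real.exp (-(2 * spread μ η)) else 1 := by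
  by_cases hk : k ∈ J
  · simp only [penalty, hk, if_true]
    rw [integral_sub (integrable_const _)
      ((integrable_const _).indicator (measurableSet_separated η)),
      integral_indicator_const _ (measurableSet_separated η)]
    have h := Real.add_one_le_exp (-(2 * spread μ η))
    rw [spread] at h ⊢
    simp only [integral_const, probReal_univ, smul_eq_mul]
    linarith
  · simp [penalty, hk]

theorem prod_penalty {ι : Type*} [Fintype ι] [DecidableEq ι] (J : Finset ι) (η : ℝ)
    (q : ι → ℂ × ℂ) :
    ∏ k, penalty J η k (q k) =
      Real.exp (-((J.filter fun k => η ≤ ‖(q k).1 - (q k).2‖).card : ℝ)) := by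
  have (k : ι) : penalty J η k (q k) =
      if k ∈ J.filter (fun k => η ≤ ‖(q k).1 - (q k).2‖) then Real.exp (-1) else 1 := by
    by_cases hk : k ∈ J <;> by_cases h : η ≤ ‖(q k).1 - (q k).2‖ <;> simp [penalty, hk, h]
  simp_rw [this]
  rw [Finset.prod_ite_mem, Finset.univ_inter, Finset.prod_const, ← Real.exp_nat_mul]
  simp

/-- Kolmogorov–Rogozin type bound for weighted sums of finitely many i.i.d. variables. -/
theorem pi_real_norm_sum_lt_le {ι : Type*} [Fintype ι] [DecidableEq ι] (μ : Measure ℂ)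
    [IsProbabilityMeasure μ] (a : ι → ℂ) (J : Finset ι) (hJ : 0 < J.card) {r η : ℝ}
    (ha : ∀ k ∈ J, 4 * r ≤ ‖a k‖ * η) (hη : 0 < spread μ η) :
    (Measure.pi fun _ : ι => μ).real {x | ‖∑ k, a k * x k‖ < r} ≤
      3 / √(spread μ η * J.card) := by
  set κ := spread μ η with hκ
  set ν := Measure.pi fun _ : ι => μ.prod μ with hν
  set B : Set (ι → ℂ) := {x | ‖∑ k, a k * x k‖ < r} with hB
  have hBm : MeasurableSet B := measurableSet_lt (by fun_prop) measurable_const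
  have hJ' : (0 : ℝ) < κ * J.card := by positivity
  have hselm (e : Finset ι) : MeasurableSet (select e ⁻¹' B) :=
    (measurePreserving_select μ e).measurable hBm
  have hsel (e : Finset ι) : ν.real (select e ⁻¹' B) = (Measure.pi fun _ : ι => μ).real B :=
    (measurePreserving_select μ e).measureReal_preimage hBm.nullMeasurableSet
  have hint (e : Finset ι) : Integrable ((select e ⁻¹' B).indicator fun _ => (1 : ℝ)) ν :=
    (integrable_const _).indicator (hselm e)
  have hpint : Integrable (fun q : ι → ℂ × ℂ => ∏ k, penalty J η k (q k)) ν := by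
    refine Integrable.fintype_prod fun k => ?_
    unfold penalty
    by_cases hk : k ∈ J
    · simp only [hk, if_true]
      exact (integrable_const _).sub ((integrable_const _).indicator (measurableSet_separated η))
    · simp [hk]
  -- With `m` good pairs in `J`: if `m ≥ κ |J|`, Littlewood–Offord gives the first term. Otherwise
  -- the trivial count suffices, as the Chernoff factor `exp (κ |J| - m)` exceeds 1.
  have hpoint (q : ι → ℂ × ℂ) : ∑ e : Finset ι, (select e ⁻¹' B).indicator (fun _ => (1 : ℝ)) q ≤
      2 ^ Fintype.card ι *
        (2 / √(κ * J.card) + Real.exp (κ * J.card) * ∏ k, penalty J η k (q k)) := by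
    set m := (J.filter fun k => η ≤ ‖(q k).1 - (q k).2‖).card with hm
    have hcount : ∑ e : Finset ι, (select e ⁻¹' B).indicator (fun _ => (1 : ℝ)) q =
        (Finset.univ.filter fun e : Finset ι =>
          ‖∑ k, a k * (q k).2 + ∑ k ∈ e, a k * ((q k).1 - (q k).2)‖ < r).card := by
      rw [Finset.card_filter, Nat.cast_sum]
      refine Finset.sum_congr rfl fun e _ => ?_
      rw [← sum_mul_select]
      by_cases he : ‖∑ k, a k * select e q k‖ < r
      · rw [Set.indicator_of_mem (show q ∈ select e ⁻¹' B from he), if_pos he, Nat.cast_one]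
      · rw [Set.indicator_of_notMem (show q ∉ select e ⁻¹' B from he), if_neg he, Nat.cast_zero]
    rw [hcount, prod_penalty, ← hm, ← Real.exp_add]
    rcases le_or_gt (κ * J.card) m with h | h
    · refine (card_norm_sum_lt_le (fun k => a k * ((q k).1 - (q k).2))
        (J.filter fun k => η ≤ ‖(q k).1 - (q k).2‖) (fun k hk => ?_) _).trans ?_
      · rw [Finset.mem_filter] at hk
        rw [norm_mul]
        exact (ha k hk.1).trans (mul_le_mul_of_nonneg_left hk.2 (norm_nonneg _))
      · refine mul_le_mul_of_nonneg_left ?_ (by positivity)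
        have : 2 / √((m : ℝ) + 1) ≤ 2 / √(κ * J.card) := by
          gcongr
          linarith
        have h2 := Real.exp_pos (κ * J.card + -(m : ℝ))
        linarith
    · have h1 : ((Finset.univ.filter fun e : Finset ι =>
          ‖∑ k, a k * (q k).2 + ∑ k ∈ e, a k * ((q k).1 - (q k).2)‖ < r).card : ℝ) ≤
          2 ^ Fintype.card ι := by
        have := Finset.card_le_univ (Finset.univ.filter fun e : Finset ι =>
          ‖∑ k, a k * (q k).2 + ∑ k ∈ e, a k * ((q k).1 - (q k).2)‖ < r)
        rw [Fintype.card_finset] at this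
        exact_mod_cast this
      have h2 : 1 ≤ Real.exp (κ * J.card + -(m : ℝ)) := Real.one_le_exp (by linarith)
      have h3 : 0 ≤ 2 / √(κ * J.card) := by positivity
      refine h1.trans (le_mul_of_one_le_right (by positivity) (by linarith))
  have hprod : ∫ q, ∏ k, penalty J η k (q k) ∂ν ≤ Real.exp (-(2 * (κ * J.card))) := by
    rw [hν, integral_fintype_prod_eq_prod (𝕜 := ℝ) (penalty J η)]
    calc ∏ k, ∫ q, penalty J η k q ∂(μ.prod μ)
        ≤ ∏ k, if k ∈ J then Real.exp (-(2 * κ)) else 1 := by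
          refine Finset.prod_le_prod (fun k _ => integral_nonneg fun q => ?_)
            fun k _ => integral_penalty_le μ J η k
          by_cases hk : k ∈ J <;> by_cases h : η ≤ ‖q.1 - q.2‖ <;>
            simp [penalty, hk, h, Real.exp_nonneg]
      _ = Real.exp (-(2 * (κ * J.card))) := by
          rw [Finset.prod_ite_mem, Finset.univ_inter, Finset.prod_const, ← Real.exp_nat_mul]
          congr 1
          ring
  -- Every selection `e` yields the same law, so averaging over `e` and `q` recovers the original
  -- probability.
  have hsum : 2 ^ Fintype.card ι * (Measure.pi fun _ : ι => μ).real B ≤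
      2 ^ Fintype.card ι *
        (2 / √(κ * J.card) + Real.exp (κ * J.card) * Real.exp (-(2 * (κ * J.card)))) := by
    calc 2 ^ Fintype.card ι * (Measure.pi fun _ : ι => μ).real B
        = ∑ e : Finset ι, ∫ q, (select e ⁻¹' B).indicator (fun _ => (1 : ℝ)) q ∂ν := by
          simp_rw [integral_indicator_const _ (hselm _), hsel]
          simp
      _ = ∫ q, ∑ e : Finset ι, (select e ⁻¹' B).indicator (fun _ => (1 : ℝ)) q ∂ν :=
          (integral_finsetSum _ fun e _ => hint e).symm
      _ ≤ ∫ q, 2 ^ Fintype.card ι *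
          (2 / √(κ * J.card) + Real.exp (κ * J.card) * ∏ k, penalty J η k (q k)) ∂ν :=
          integral_mono (integrable_finsetSum _ fun e _ => hint e)
            (((integrable_const _).add (hpint.const_mul _)).const_mul _) hpoint
      _ = 2 ^ Fintype.card ι * (2 / √(κ * J.card) +
            Real.exp (κ * J.card) * ∫ q, ∏ k, penalty J η k (q k) ∂ν) := by
          rw [integral_const_mul, integral_add (integrable_const _) (hpint.const_mul _),
            integral_const_mul]
          simp
      _ ≤ _ := by gcongr
  have hfin := le_of_mul_le_mul_left hsum (by positivity)
  rw [← Real.exp_add, show κ * J.card + -(2 * (κ * J.card)) = -(κ * J.card) by ring] at hfin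
  have := exp_neg_le_one_div_sqrt hJ'
  calc _ ≤ 2 / √(κ * J.card) + 1 / √(κ * J.card) := by linarith
    _ = _ := by ring

/-- The disc is open, so a limit inside it has all late partial sums inside; continuity from below
finishes. -/
theorem measureReal_norm_lt_le_of_tendsto {Ω : Type*} [MeasurableSpace Ω] (P : Measure Ω)
    [IsFiniteMeasure P] {S : ℕ → Ω → ℂ} {S' : Ω → ℂ}
    (h : ∀ᵐ ω ∂P, Tendsto (fun N => S N ω) atTop (𝓝 (S' ω))) {r b : ℝ}
    (hb : ∀ᶠ N in atTop, P.real {ω | ‖S N ω‖ < r} ≤ b) : P.real {ω | ‖S' ω‖ < r} ≤ b := by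
  obtain ⟨N₀, hN₀⟩ := eventually_atTop.1 hb
  have hb0 : 0 ≤ b := measureReal_nonneg.trans (hN₀ N₀ le_rfl)
  set T : ℕ → Set Ω := fun N => {ω | ∀ M, N ≤ M → ‖S M ω‖ < r} with hT
  have hmono : Monotone T := fun N N' hN ω hω M hM => hω M (hN.trans hM)
  have h1 : P {ω | ‖S' ω‖ < r} ≤ P (⋃ N, T N) := by
    refine measure_mono_ae ?_
    filter_upwards [h] with ω hω hr
    obtain ⟨N, hN⟩ := eventually_atTop.1 (hω.norm.eventually_lt_const hr)
    exact Set.mem_iUnion.2 ⟨N, hN⟩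
  have h2 : P (⋃ N, T N) ≤ ENNReal.ofReal b := by
    rw [(directed_of_isDirected_le hmono).measure_iUnion]
    refine iSup_le fun N => ?_
    rw [← ofReal_measureReal]
    refine ENNReal.ofReal_le_ofReal (le_trans ?_ (hN₀ (max N N₀) (le_max_right _ _)))
    exact measureReal_mono fun ω hω => hω _ (le_max_left _ _)
  exact ENNReal.toReal_le_of_le_ofReal hb0 (h1.trans h2)

theorem measureReal_norm_tsum_lt_le {Ω : Type*} [MeasurableSpace Ω] (P : Measure Ω)
    [IsProbabilityMeasure P] {ξ : ℕ → Ω → ℂ} (hmeas : ∀ k, Measurable (ξ k))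
    (hindep : iIndepFun ξ P) (hident : ∀ k, IdentDistrib (ξ k) (ξ 0) P P) (a : ℕ → ℂ)
    (hsum : ∀ᵐ ω ∂P, Summable fun k => a k * ξ k ω) (J : Finset ℕ) (hJ : 0 < J.card) {r η : ℝ}
    (ha : ∀ k ∈ J, 4 * r ≤ ‖a k‖ * η) (hη : 0 < spread (P.map (ξ 0)) η) :
    P.real {ω | ‖∑' k, a k * ξ k ω‖ < r} ≤ 3 / √(spread (P.map (ξ 0)) η * J.card) := by
  have hprob : IsProbabilityMeasure (P.map (ξ 0)) :=
    Measure.isProbabilityMeasure_map (hmeas 0).aemeasurable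
  refine measureReal_norm_lt_le_of_tendsto P
    (S := fun N ω => ∑ k ∈ Finset.range N, a k * ξ k ω) ?_ ?_
  · filter_upwards [hsum] with ω hω using hω.hasSum.tendsto_sum_nat
  · filter_upwards [eventually_gt_atTop (J.sup id)] with N hN
    have hJN : ∀ k ∈ J, k < N := fun k hk => (Finset.le_sup (f := id) hk).trans_lt hN
    have hmap : P.map (fun ω (k : Fin N) => ξ k ω) = Measure.pi fun _ : Fin N => P.map (ξ 0) := by
      rw [(iIndepFun_iff_map_fun_eq_pi_map fun k : Fin N => (hmeas k).aemeasurable).1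
        (hindep.precomp Fin.val_injective)]
      congr 1
      ext1 k
      exact (hident k).map_eq
    have hB := pi_real_norm_sum_lt_le (P.map (ξ 0)) (fun k : Fin N => a k) (J.attachFin hJN)
      (by rwa [Finset.card_attachFin]) (fun k hk => ha k (Finset.mem_attachFin _ |>.1 hk)) hη
    rw [← hmap, map_measureReal_apply (by fun_prop)
      (measurableSet_lt (by fun_prop) measurable_const), Finset.card_attachFin] at hB
    convert hB using 3
    ext ω
    simp [Finset.sum_range]

/-- Otherwise two independent copies agree almost surely, and Fubini makes the law a point mass. -/
theorem exists_spread_pos (μ : Measure ℂ) [IsProbabilityMeasure μ]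
    (h : ¬ ∃ a : ℂ, ∀ᵐ x ∂μ, x = a) : ∃ η, 0 < η ∧ 0 < spread μ η := by
  by_contra! hcon
  have he : 0 < 1 - Real.exp (-1) := by
    have : Real.exp (-1) < 1 := by simp
    linarith
  have hzero (η : ℝ) (hη : 0 < η) : (μ.prod μ) {q | η ≤ ‖q.1 - q.2‖} = 0 := by
    have h1 := hcon η hη
    rw [spread] at h1
    have h2 : (μ.prod μ).real {q | η ≤ ‖q.1 - q.2‖} ≤ 0 := by
      by_contra! h3
      have := mul_pos h3 he
      linarith
    exact (measureReal_eq_zero_iff).1 (le_antisymm h2 measureReal_nonneg)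
  have hae : ∀ᵐ q ∂(μ.prod μ), q.1 = q.2 := by
    have h1 : ∀ᵐ q ∂(μ.prod μ), ∀ n : ℕ, ¬ (1 / ((n : ℝ) + 1) ≤ ‖q.1 - q.2‖) :=
      ae_all_iff.2 fun n => by
        rw [ae_iff]
        simpa using hzero (1 / ((n : ℝ) + 1)) (by positivity)
    filter_upwards [h1] with q hq
    by_contra hne
    obtain ⟨n, hn⟩ := exists_nat_one_div_lt (norm_pos_iff.2 (sub_ne_zero.2 hne))
    exact hq n hn.le
  obtain ⟨a, ha⟩ := (Measure.ae_ae_of_ae_prod hae).exists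
  exact h ⟨a, ha.mono fun x hx => hx.symm⟩

/-! ### Exponential estimates for the coefficients and the profile. -/

theorem mul_rpow_le_one_of_lt_rpow {x r : ℝ≥0} {t : ℝ} (ht : 0 < t)
    (h : (r : ℝ≥0∞) < (x : ℝ≥0∞) ^ (-(1 / t))) : (x : ℝ) * (r : ℝ) ^ t ≤ 1 := by
  have h1 : (r : ℝ≥0∞) ^ t ≤ (x : ℝ≥0∞)⁻¹ := by
    refine (ENNReal.rpow_le_rpow h.le ht.le).trans ?_
    rw [← ENNReal.rpow_mul, show -(1 / t) * t = -1 by field_simp, ENNReal.rpow_neg_one]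
  rw [ENNReal.le_inv_iff_mul_le, ← ENNReal.coe_rpow_of_nonneg _ ht.le, ← ENNReal.coe_mul,
    ← ENNReal.coe_one, ENNReal.coe_le_coe] at h1
  rw [mul_comm]
  exact_mod_cast h1

theorem exists_forall_mul_rpow_le_one {f : ℝ≥0 → ℝ≥0} {r : ℝ≥0} (hr : (r : ℝ≥0∞) < radius f) :
    ∃ A : ℝ≥0, ∀ t, A ≤ t → (f t : ℝ) * (r : ℝ) ^ (t : ℝ) ≤ 1 := by
  have h := (eventually_lt_of_lt_liminf hr).and (eventually_gt_atTop 0)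
  obtain ⟨A, hA⟩ := eventually_atTop.1 h
  exact ⟨A, fun t ht => mul_rpow_le_one_of_lt_rpow (by exact_mod_cast (hA t ht).2) (hA t ht).1⟩

theorem eventually_jointAtTop {p : ℕ × ℕ → Prop} (h : ∀ᶠ x in jointAtTop, p x) :
    ∃ A : ℝ, ∀ᶠ n : ℕ in atTop, ∀ k : ℕ, A * n ≤ k → p (k, n) := by
  rw [jointAtTop, eventually_comap, prod_atTop_atTop_eq, eventually_atTop] at h
  obtain ⟨⟨N, A⟩, h⟩ := h
  refine ⟨A, ?_⟩
  filter_upwards [eventually_gt_atTop 0, tendsto_natCast_atTop_atTop.eventually_ge_atTop N]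
    with n hn hN k hk
  refine h ((n : ℝ), (k : ℝ) / n) ⟨hN, ?_⟩ (k, n) rfl
  change A ≤ (k : ℝ) / n
  rwa [le_div_iff₀ (by exact_mod_cast hn)]

namespace Assumptions

variable {F : ℕ → ℕ → ℂ} {f : ℝ≥0 → ℝ≥0} {T₀ : ℝ≥0∞}

theorem exists_coeff_mul_pow_le_one (hA : Assumptions F f T₀) {r : ℝ≥0}
    (hr : (r : ℝ≥0∞) < radius f) :
    ∃ A : ℝ, 0 < A ∧ ∀ᶠ n : ℕ in atTop, ∀ k : ℕ, A * n ≤ k → ‖F k n‖ * (r : ℝ) ^ k ≤ 1 := by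
  obtain ⟨A, h⟩ := eventually_jointAtTop (eventually_lt_of_lt_liminf (hr.trans_le hA.a4_liminf))
  refine ⟨max A 1, by positivity, ?_⟩
  filter_upwards [h, eventually_gt_atTop 0] with n hn hn0 k hk
  have hn0' : (0 : ℝ) < n := by exact_mod_cast hn0
  have hk0 : (0 : ℝ) < k := lt_of_lt_of_le (by positivity) hk
  have h1 := hn k (le_trans (by gcongr; exact le_max_left _ _) hk)
  have h2 := mul_rpow_le_one_of_lt_rpow (x := ‖F k n‖₊) hk0 h1
  rwa [Real.rpow_natCast] at h2

theorem continuousAt (hA : Assumptions F f T₀) {t : ℝ≥0} (ht : (t : ℝ≥0∞) < T₀) :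
    ContinuousAt f t :=
  hA.a2_cont.continuousAt
    ((isOpen_Iio.preimage ENNReal.continuous_coe).mem_nhds (show (t : ℝ≥0∞) ∈ Set.Iio T₀ from ht))

theorem exists_bound_Iic (hA : Assumptions F f T₀) (A : ℝ≥0) : ∃ C : ℝ≥0, ∀ t ≤ A, f t ≤ C := by
  have main (B : ℝ≥0) (h : ContinuousOn f (Set.Icc 0 B)) : ∃ C : ℝ≥0, ∀ t ≤ B, f t ≤ C := by
    obtain ⟨C, hC⟩ := (isCompact_Icc.bddAbove_image h)
    exact ⟨C, fun t ht => hC ⟨t, ⟨zero_le, ht⟩, rfl⟩⟩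
  rcases lt_or_ge (A : ℝ≥0∞) T₀ with h | h
  · exact main A fun t ht =>
      (hA.continuousAt ((ENNReal.coe_le_coe.2 ht.2).trans_lt h)).continuousWithinAt
  -- Here `T₀` is finite: left continuity makes `f` bounded on the compact `[0, T₀]`, and `f`
  -- vanishes beyond.
  · obtain ⟨T, hT⟩ : ∃ T : ℝ≥0, (T : ℝ≥0∞) = T₀ :=
      ⟨_, ENNReal.coe_toNNReal (ne_top_of_le_ne_top ENNReal.coe_ne_top h)⟩
    obtain ⟨C, hC⟩ := main T fun t ht => by
      rcases ht.2.lt_or_eq with h1 | h1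
      · exact (hA.continuousAt (hT ▸ ENNReal.coe_lt_coe.2 h1)).continuousWithinAt
      · rw [h1]
        exact (hA.a2_left T hT.symm).mono fun x hx => hx.2
    refine ⟨C, fun t _ => ?_⟩
    rcases le_or_gt t T with h1 | h1
    · exact hC t h1
    · rw [hA.a1_zero t (hT ▸ ENNReal.coe_lt_coe.2 h1)]
      exact zero_le

theorem exists_bound (hA : Assumptions F f T₀) {W : ℝ} (hW : 0 < W) {r : ℝ≥0}
    (hWr : W < r) (hr : (r : ℝ≥0∞) < radius f) :
    ∃ K : ℝ, ∀ t : ℝ≥0, (f t : ℝ) * W ^ (t : ℝ) ≤ K := by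
  obtain ⟨A, h⟩ := exists_forall_mul_rpow_le_one hr
  obtain ⟨C, hC⟩ := hA.exists_bound_Iic A
  refine ⟨max (C * (max 1 W) ^ (A : ℝ)) 1, fun t => ?_⟩
  rcases le_total A t with ht | ht
  · refine le_max_of_le_right (le_trans ?_ (h t ht))
    gcongr
  · refine le_max_of_le_left ?_
    gcongr
    · exact hC t ht
    · calc W ^ (t : ℝ) ≤ (max 1 W) ^ (t : ℝ) := by gcongr; exact le_max_right _ _
        _ ≤ _ := Real.rpow_le_rpow_of_exponent_le (le_max_left _ _) (by exact_mod_cast ht)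

end Assumptions

theorem rpow_one_div_pow {x : ℝ} (hx : 0 ≤ x) {n : ℕ} (hn : n ≠ 0) :
    (x ^ (1 / (n : ℝ))) ^ n = x := by
  rw [one_div, Real.rpow_inv_natCast_pow hx hn]

theorem log_ofReal_le_coe_iff {x c : ℝ} :
    ENNReal.log (ENNReal.ofReal x) ≤ (c : EReal) ↔ x ≤ Real.exp c := by
  rw [ENNReal.log_ofReal]
  split_ifs with h
  · simpa using h.trans (Real.exp_pos c).le
  · rw [EReal.coe_le_coe_iff, Real.log_le_iff_le_exp (not_le.1 h)]

theorem legendreI_eq (f : ℝ≥0 → ℝ≥0) {W : ℝ} (hW : 0 < W) :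
    legendreI f (Real.log W) =
      ⨆ t : ℝ≥0, ENNReal.log (ENNReal.ofReal ((f t : ℝ) * W ^ (t : ℝ))) := by
  refine iSup_congr fun t => ?_
  rw [ENNReal.ofReal_mul (by positivity), ENNReal.log_mul_add, ENNReal.ofReal_coe_nnreal,
    ENNReal.log_ofReal, if_neg (not_le.2 (by positivity)), Real.log_rpow hW, add_comm,
    mul_comm (t : ℝ)]

/-- `f 0 > 0` excludes `-∞` and the bound `K` excludes `+∞`. The exponential form spares later
estimates any logarithm of 0. -/
theorem exists_legendreI_eq_coe {f : ℝ≥0 → ℝ≥0} {W K : ℝ} (hW : 0 < W) (hf : 0 < f 0)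
    (hK : ∀ t : ℝ≥0, (f t : ℝ) * W ^ (t : ℝ) ≤ K) :
    ∃ c : ℝ, legendreI f (Real.log W) = (c : EReal) ∧
      (∀ t : ℝ≥0, (f t : ℝ) * W ^ (t : ℝ) ≤ Real.exp c) ∧
      ∀ ε : ℝ, 0 < ε → ∃ t : ℝ≥0, Real.exp (c - ε) < (f t : ℝ) * W ^ (t : ℝ) := by
  have h0 : 0 < (f 0 : ℝ) * W ^ ((0 : ℝ≥0) : ℝ) := by
    have : (0 : ℝ) < f 0 := by exact_mod_cast hf
    positivity
  have hK0 : 0 < K := h0.trans_le (hK 0)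
  have hle : legendreI f (Real.log W) ≤ (Real.log K : EReal) := by
    rw [legendreI_eq f hW]
    refine iSup_le fun t => log_ofReal_le_coe_iff.2 ?_
    rw [Real.exp_log hK0]
    exact hK t
  have hne_bot : legendreI f (Real.log W) ≠ ⊥ := by
    intro h
    have h1 := le_iSup (fun t : ℝ≥0 => ENNReal.log (ENNReal.ofReal ((f t : ℝ) * W ^ (t : ℝ)))) 0
    rw [← legendreI_eq f hW, h, le_bot_iff, ENNReal.log_ofReal, if_neg h0.not_ge] at h1
    exact EReal.coe_ne_bot _ h1
  have hne_top : legendreI f (Real.log W) ≠ ⊤ := ne_top_of_le_ne_top (EReal.coe_ne_top _) hle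
  refine ⟨(legendreI f (Real.log W)).toReal, (EReal.coe_toReal hne_top hne_bot).symm, ?_, ?_⟩
  · intro t
    rw [← log_ofReal_le_coe_iff, EReal.coe_toReal hne_top hne_bot, legendreI_eq f hW]
    exact le_iSup (fun t : ℝ≥0 => ENNReal.log (ENNReal.ofReal ((f t : ℝ) * W ^ (t : ℝ)))) t
  · intro ε hε
    by_contra! h
    have h1 : legendreI f (Real.log W) ≤ (((legendreI f (Real.log W)).toReal - ε : ℝ) : EReal) := by
      conv_lhs => rw [legendreI_eq f hW]
      exact iSup_le fun t => log_ofReal_le_coe_iff.2 (h t)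
    conv_lhs at h1 => rw [← EReal.coe_toReal hne_top hne_bot]
    rw [EReal.coe_le_coe_iff] at h1
    linarith

namespace Assumptions

variable {F : ℕ → ℕ → ℂ} {f : ℝ≥0 → ℝ≥0} {T₀ : ℝ≥0∞}

/-- A near-maximizer must be widened to an interval so that order `n` indices `k` are available. It
extends to the right if `t₀ < T₀`, to the left if `t₀ = T₀`. -/
theorem exists_Icc_lt (hA : Assumptions F f T₀) {W b : ℝ} (hW : 0 < W) (hb : 0 < b)
    {t₀ : ℝ≥0} (ht₀ : b < (f t₀ : ℝ) * W ^ (t₀ : ℝ)) :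
    ∃ l u : ℝ≥0, l < u ∧ ∀ t ∈ Set.Icc l u, b < (f t : ℝ) * W ^ (t : ℝ) := by
  have hcont (s : Set ℝ≥0) (h : ContinuousWithinAt f s t₀) :
      ∀ᶠ t in 𝓝[s] t₀, b < (f t : ℝ) * W ^ (t : ℝ) := by
    have h1 : ContinuousWithinAt (fun t : ℝ≥0 => (f t : ℝ) * W ^ (t : ℝ)) s t₀ := by
      refine (NNReal.continuous_coe.continuousAt.comp_continuousWithinAt h).mul ?_
      exact ((Real.continuous_const_rpow hW.ne').comp NNReal.continuous_coe).continuousWithinAt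
    exact h1.eventually (lt_mem_nhds ht₀)
  rcases lt_trichotomy (t₀ : ℝ≥0∞) T₀ with h | h | h
  · have h1 := hcont (Set.Ici t₀) (hA.continuousAt h).continuousWithinAt
    obtain ⟨u, hu, hsub⟩ := mem_nhdsGE_iff_exists_Icc_subset.1 h1
    exact ⟨t₀, u, hu, fun t ht => hsub ht⟩
  · have h1 := hcont (Set.Iic t₀) (hA.a2_left t₀ h.symm)
    have hpos : 0 < t₀ := by
      have := hA.T₀_pos
      rw [← h] at this
      exact_mod_cast this
    obtain ⟨l', hl', hsub⟩ := (mem_nhdsLE_iff_exists_Ioc_subset' hpos).1 h1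
    obtain ⟨l, hl'l, hl⟩ := exists_between (Set.mem_Iio.1 hl')
    exact ⟨l, t₀, hl, fun t ht => hsub ⟨hl'l.trans_le ht.1, ht.2⟩⟩
  · rw [hA.a1_zero t₀ h] at ht₀
    simp at ht₀
    linarith

theorem eventually_abs_rpow_sub_le (hA : Assumptions F f T₀) {W : ℝ} (hW : 0 < W) {A ε : ℝ}
    (hA0 : 0 < A) (hε : 0 < ε) : ∀ᶠ n : ℕ in atTop, ∀ k : ℕ, (k : ℝ) ≤ A * n →
      |(‖F k n‖ * W ^ k) ^ (1 / (n : ℝ)) -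
        (f ((k : ℝ≥0) / (n : ℝ≥0)) : ℝ) * W ^ (((k : ℝ≥0) / (n : ℝ≥0) : ℝ≥0) : ℝ)| ≤ ε := by
  set K : ℝ := (max 1 W) ^ A with hK
  have hKpos : 0 < K := by positivity
  filter_upwards [hA.a3 A hA0 (ε / K) (by positivity), eventually_gt_atTop 0] with n hn hn0 k hk
  have hn0' : (0 : ℝ) < n := by exact_mod_cast hn0
  have h1 : (W ^ k) ^ (1 / (n : ℝ)) = W ^ (((k : ℝ≥0) / (n : ℝ≥0) : ℝ≥0) : ℝ) := by
    rw [← Real.rpow_natCast, ← Real.rpow_mul hW.le]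
    congr 1
    push_cast
    ring
  have h2 : W ^ (((k : ℝ≥0) / (n : ℝ≥0) : ℝ≥0) : ℝ) ≤ K := by
    calc W ^ (((k : ℝ≥0) / (n : ℝ≥0) : ℝ≥0) : ℝ)
        ≤ (max 1 W) ^ (((k : ℝ≥0) / (n : ℝ≥0) : ℝ≥0) : ℝ) := by gcongr; exact le_max_right _ _
      _ ≤ _ := by
        refine Real.rpow_le_rpow_of_exponent_le (le_max_left _ _) ?_
        push_cast
        rwa [div_le_iff₀ hn0']
  rw [Real.mul_rpow (norm_nonneg _) (by positivity), h1, ← sub_mul, abs_mul,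
    abs_of_nonneg (by positivity : 0 ≤ W ^ (((k : ℝ≥0) / (n : ℝ≥0) : ℝ≥0) : ℝ))]
  calc _ ≤ ε / K * K := by gcongr; exact hn k hk
    _ = ε := by field_simp

theorem eventually_coeff_mul_pow_le (hA : Assumptions F f T₀) {W c : ℝ} (hW : 0 < W)
    (hc : ∀ t : ℝ≥0, (f t : ℝ) * W ^ (t : ℝ) ≤ Real.exp c) {A ε : ℝ} (hA0 : 0 < A) (hε : 0 < ε) :
    ∀ᶠ n : ℕ in atTop, ∀ k : ℕ, (k : ℝ) ≤ A * n → ‖F k n‖ * W ^ k ≤ Real.exp (n * (c + ε)) := by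
  have hpos : 0 < Real.exp (c + ε) - Real.exp c := by
    rw [sub_pos, Real.exp_lt_exp]; linarith
  filter_upwards [hA.eventually_abs_rpow_sub_le hW hA0 hpos, eventually_gt_atTop 0]
    with n hn hn0 k hk
  rw [Real.exp_nat_mul, ← rpow_one_div_pow (x := ‖F k n‖ * W ^ k) (by positivity) hn0.ne']
  refine pow_le_pow_left₀ (by positivity) ?_ n
  have h1 := (abs_le.1 (hn k hk)).2
  have h2 := hc ((k : ℝ≥0) / (n : ℝ≥0))
  linarith

theorem exists_eventually_le_coeff_mul_pow (hA : Assumptions F f T₀) {W c : ℝ} (hW : 0 < W)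
    (hc : ∀ ε : ℝ, 0 < ε → ∃ t : ℝ≥0, Real.exp (c - ε) < (f t : ℝ) * W ^ (t : ℝ))
    {ε : ℝ} (hε : 0 < ε) :
    ∃ l u : ℝ≥0, l < u ∧ ∀ᶠ n : ℕ in atTop, ∀ k : ℕ, l * (n : ℝ) ≤ k → (k : ℝ) ≤ u * n →
      Real.exp (n * (c - ε)) ≤ ‖F k n‖ * W ^ k := by
  obtain ⟨t₀, ht₀⟩ := hc (ε / 2) (by positivity)
  obtain ⟨l, u, hlu, h⟩ := hA.exists_Icc_lt hW (Real.exp_pos _) ht₀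
  have hu : (0 : ℝ) < u := by exact_mod_cast (zero_le (a := l)).trans_lt hlu
  have hpos : 0 < Real.exp (c - ε / 2) - Real.exp (c - ε) := by
    rw [sub_pos, Real.exp_lt_exp]; linarith
  refine ⟨l, u, hlu, ?_⟩
  filter_upwards [hA.eventually_abs_rpow_sub_le hW hu hpos, eventually_gt_atTop 0]
    with n hn hn0 k hkl hku
  have hn0' : (0 : ℝ) < n := by exact_mod_cast hn0
  rw [Real.exp_nat_mul, ← rpow_one_div_pow (x := ‖F k n‖ * W ^ k) (by positivity) hn0.ne']
  refine pow_le_pow_left₀ (by positivity) ?_ n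
  have h1 := (abs_le.1 (hn k hku)).1
  have h2 := h ((k : ℝ≥0) / (n : ℝ≥0)) (by
    rw [Set.mem_Icc, ← NNReal.coe_le_coe, ← NNReal.coe_le_coe]
    push_cast
    exact ⟨(le_div_iff₀ hn0').2 hkl, (div_le_iff₀ hn0').2 hku⟩)
  linarith

/-- Of the decay `2 * δ * k`, one half will pay for the growth of `ξ k` and the other will make the
series geometric. -/
theorem exists_eventually_coeff_mul_pow_le (hA : Assumptions F f T₀) {W c : ℝ} (hW : 0 < W)
    {r : ℝ≥0} (hWr : W < r) (hr : (r : ℝ≥0∞) < radius f)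
    (hc : ∀ t : ℝ≥0, (f t : ℝ) * W ^ (t : ℝ) ≤ Real.exp c) {ε : ℝ} (hε : 0 < ε) :
    ∃ δ : ℝ, 0 < δ ∧ δ ≤ ε ∧ ∀ᶠ n : ℕ in atTop, ∀ k : ℕ,
      ‖F k n‖ * W ^ k ≤ Real.exp (n * (c + ε) - 2 * δ * k) := by
  obtain ⟨A₁, hA₁, htail⟩ := hA.exists_coeff_mul_pow_le_one hr
  have hr0 : (0 : ℝ) < r := hW.trans hWr
  set δ₀ : ℝ := Real.log (r / W) / 2 with hδ₀
  have hδ₀pos : 0 < δ₀ := by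
    have := Real.log_pos ((one_lt_div hW).2 hWr)
    positivity
  have hWr' : W = r * Real.exp (-(2 * δ₀)) := by
    rw [hδ₀, mul_div_cancel₀ _ two_ne_zero, Real.exp_neg, Real.exp_log (by positivity)]
    field_simp
  -- For `k ≥ A n` the ratio `(W / r) ^ k = exp (-2 δ₀ k)` must also beat `exp (n c)` when `c < 0`,
  -- hence `|c| / δ₀`. For `k ≤ A n` the loss `2 δ k` is at most `n ε / 2`, hence `ε / (4 A)` below.
  set A : ℝ := max A₁ (|c| / δ₀) with hAdef
  have hApos : 0 < A := lt_max_of_lt_left hA₁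
  have hcA : |c| ≤ δ₀ * A := by
    rw [mul_comm, ← div_le_iff₀ hδ₀pos]
    exact le_max_right _ _
  refine ⟨min (min (δ₀ / 2) (ε / (4 * A))) ε, by positivity, min_le_right _ _, ?_⟩
  set δ := min (min (δ₀ / 2) (ε / (4 * A))) ε with hδ
  have hδ1 : δ ≤ δ₀ / 2 := (min_le_left _ _).trans (min_le_left _ _)
  have hδ2 : δ * (4 * A) ≤ ε := by
    rw [← le_div_iff₀ (by positivity)]
    exact (min_le_left _ _).trans (min_le_right _ _)
  have hδpos : 0 < δ := by positivity
  filter_upwards [htail, hA.eventually_coeff_mul_pow_le hW hc hApos (half_pos hε)]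
    with n hn1 hn2 k
  have hn0 : (0 : ℝ) ≤ n := by positivity
  have hk0 : (0 : ℝ) ≤ k := by positivity
  rcases le_total (k : ℝ) (A * n) with hk | hk
  · refine (hn2 k hk).trans (Real.exp_le_exp.2 ?_)
    have h1 : δ * k ≤ δ * (A * n) := by gcongr
    have h2 : δ * (4 * A) * n ≤ ε * n := by gcongr
    linarith
  · have h1 := hn1 k (le_trans (by gcongr; exact le_max_left _ _) hk)
    have h2 : ‖F k n‖ * W ^ k = ‖F k n‖ * (r : ℝ) ^ k * Real.exp (-(2 * δ₀ * k)) := by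
      rw [hWr', mul_pow, ← Real.exp_nat_mul, mul_assoc]
      congr 3
      ring
    rw [h2]
    refine (mul_le_of_le_one_left (Real.exp_pos _).le h1).trans (Real.exp_le_exp.2 ?_)
    have h3 : δ * k ≤ δ₀ / 2 * k := by gcongr
    have h4 : δ₀ * (A * n) ≤ δ₀ * k := by gcongr
    have h5 : |c| * n ≤ δ₀ * A * n := by gcongr
    have h6 : -|c| * n ≤ c * n := by gcongr; exact neg_abs_le c
    have h7 : 0 ≤ n * ε := by positivity
    linarith

end Assumptions

/-! ### Upper and lower bounds for the random series. -/

theorem le_card_Icc_ceil_floor {x y : ℝ} (hx : 0 ≤ x) :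
    y - x - 1 ≤ ((Finset.Icc ⌈x⌉₊ ⌊y⌋₊).card : ℝ) := by
  rw [Nat.card_Icc]
  have h1 : ((⌊y⌋₊ + 1 : ℕ) : ℝ) ≤ ((⌊y⌋₊ + 1 - ⌈x⌉₊ : ℕ) : ℝ) + (⌈x⌉₊ : ℝ) := by
    rw [← Nat.cast_add, Nat.cast_le]
    omega
  have h2 := Nat.lt_floor_add_one y
  have h3 := Nat.ceil_lt_add_one hx
  push_cast at h1
  linarith

theorem summable_and_norm_series_le {Ω : Type*} {ξ : ℕ → Ω → ℂ} {F : ℕ → ℕ → ℂ}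
    {n m : ℕ} {z : ℂ} {ω : Ω} {δ b : ℝ} (hδ : 0 < δ)
    (hξ : ∀ k : ℕ, ‖ξ k ω‖ ≤ Real.exp (δ * (k + m)))
    (hF : ∀ k : ℕ, ‖F k n‖ * ‖z‖ ^ k ≤ Real.exp (b - 2 * δ * k)) :
    Summable (fun k : ℕ => ξ k ω * F k n * z ^ k) ∧
      ‖series ξ F n z ω‖ ≤ Real.exp (δ * m + b) * (1 - Real.exp (-δ))⁻¹ := by
  have hlt : Real.exp (-δ) < 1 := Real.exp_lt_one_iff.2 (by linarith)
  have hgeom := (hasSum_geometric_of_lt_one (Real.exp_pos _).le hlt).mul_left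
    (Real.exp (δ * m + b))
  have hle (k : ℕ) : ‖ξ k ω * F k n * z ^ k‖ ≤ Real.exp (δ * m + b) * Real.exp (-δ) ^ k := by
    rw [mul_assoc, norm_mul, norm_mul, norm_pow]
    calc _ ≤ Real.exp (δ * (k + m)) * Real.exp (b - 2 * δ * k) := by
          gcongr
          · exact hξ k
          · exact hF k
      _ = _ := by
          rw [← Real.exp_nat_mul, ← Real.exp_add, ← Real.exp_add]
          congr 1
          ring
  exact ⟨.of_norm_bounded hgeom.summable hle, tsum_of_norm_bounded hgeom hle⟩

theorem logPotential_mem_of_norm_series {Ω : Type*} {ξ : ℕ → Ω → ℂ} {F : ℕ → ℕ → ℂ} {n : ℕ}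
    (hn : 0 < n) {z : ℂ} {ω : Ω}
    {a b : ℝ} (ha : Real.exp (n * a) ≤ ‖series ξ F n z ω‖)
    (hb : ‖series ξ F n z ω‖ ≤ Real.exp (n * b)) :
    (a : EReal) ≤ logPotential ξ F n z ω ∧ logPotential ξ F n z ω ≤ (b : EReal) := by
  have hn' : (0 : ℝ) < n := by exact_mod_cast hn
  have hpos : 0 < ‖series ξ F n z ω‖ := (Real.exp_pos _).trans_le ha
  have hlog : logPotential ξ F n z ω =
      ((1 / (n : ℝ) * Real.log ‖series ξ F n z ω‖ : ℝ) : EReal) := by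
    rw [logPotential, ← ofReal_norm, ENNReal.log_ofReal, if_neg hpos.not_ge,
      EReal.coe_mul]
  rw [hlog, EReal.coe_le_coe_iff, EReal.coe_le_coe_iff, one_div, ← div_eq_inv_mul]
  rw [← Real.le_log_iff_exp_le hpos] at ha
  rw [← Real.log_le_iff_le_exp hpos] at hb
  exact ⟨(le_div_iff₀ hn').2 (by linarith), (div_le_iff₀ hn').2 (by linarith)⟩

section Random

variable {Ω : Type*} [MeasurableSpace Ω] {P : Measure Ω} {ξ : ℕ → Ω → ℂ}

/-- The union bound gives the tail from `m` on of `∑ P(log(1 + |ξ 0|) > δ j)`, convergent by the log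
moment. Later `m = n` serves the upper bound, and some finite `m` serves almost sure summability. -/
theorem tendsto_measure_not_forall_norm_le [IsProbabilityMeasure P]
    (hident : ∀ k, IdentDistrib (ξ k) (ξ 0) P P)
    (hlog : Integrable (fun ω => Real.log (1 + ‖ξ 0 ω‖)) P) {δ : ℝ} (hδ : 0 < δ) :
    Tendsto (fun m : ℕ => P {ω | ¬ ∀ k : ℕ, ‖ξ k ω‖ ≤ Real.exp (δ * (k + m))}) atTop (𝓝 0) := by
  set u : ℕ → ℝ≥0∞ := fun j => P {ω | (δ⁻¹ * Real.log (1 + ‖ξ 0 ω‖)) ∈ Set.Ioi (j : ℝ)} with hu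
  have hsum : ∑' j, u j < ⊤ :=
    @tsum_prob_mem_Ioi_lt_top Ω ⟨P⟩ ‹_› (fun ω => δ⁻¹ * Real.log (1 + ‖ξ 0 ω‖))
      (hlog.const_mul _) fun ω => mul_nonneg (by positivity)
        (Real.log_nonneg (le_add_of_nonneg_right (norm_nonneg _)))
  refine tendsto_of_tendsto_of_tendsto_of_le_of_le tendsto_const_nhds
    (ENNReal.tendsto_sum_nat_add u hsum.ne) (fun _ => zero_le) fun m => ?_
  have hset : {ω | ¬ ∀ k : ℕ, ‖ξ k ω‖ ≤ Real.exp (δ * (k + m))} =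
      ⋃ k : ℕ, {ω | Real.exp (δ * (k + m)) < ‖ξ k ω‖} := by
    ext ω
    simp
  rw [hset]
  refine (measure_iUnion_le _).trans (ENNReal.tsum_le_tsum fun k => ?_)
  have h1 : P {ω | Real.exp (δ * (k + m)) < ‖ξ k ω‖} =
      P {ω | Real.exp (δ * (k + m)) < ‖ξ 0 ω‖} :=
    (hident k).measure_mem_eq (s := {x | Real.exp (δ * (k + m)) < ‖x‖})
      (measurableSet_lt measurable_const measurable_norm)
  rw [h1]
  refine measure_mono fun ω hω => ?_
  have h2 : Real.exp (δ * (k + m)) < ‖ξ 0 ω‖ := hω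
  change ((k + m : ℕ) : ℝ) < δ⁻¹ * Real.log (1 + ‖ξ 0 ω‖)
  rw [lt_inv_mul_iff₀ hδ, Real.lt_log_iff_exp_lt (by positivity)]
  push_cast
  linarith

theorem ae_exists_forall_norm_le [IsProbabilityMeasure P]
    (hident : ∀ k, IdentDistrib (ξ k) (ξ 0) P P)
    (hlog : Integrable (fun ω => Real.log (1 + ‖ξ 0 ω‖)) P) {δ : ℝ} (hδ : 0 < δ) :
    ∀ᵐ ω ∂P, ∃ m : ℕ, ∀ k : ℕ, ‖ξ k ω‖ ≤ Real.exp (δ * (k + m)) := by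
  rw [ae_iff, ← nonpos_iff_eq_zero]
  refine ge_of_tendsto' (tendsto_measure_not_forall_norm_le hident hlog hδ) fun m => ?_
  exact measure_mono fun ω hω h => hω ⟨m, h⟩

theorem tendsto_measure_lt_norm_series [IsProbabilityMeasure P]
    (hident : ∀ k, IdentDistrib (ξ k) (ξ 0) P P)
    (hlog : Integrable (fun ω => Real.log (1 + ‖ξ 0 ω‖)) P)
    {F : ℕ → ℕ → ℂ} {z : ℂ} {c ε δ : ℝ} (hδ : 0 < δ) (hδε : 2 * δ < ε)
    (hF : ∀ᶠ n : ℕ in atTop, ∀ k : ℕ,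
      ‖F k n‖ * ‖z‖ ^ k ≤ Real.exp (n * (c + ε / 2) - 2 * δ * k)) :
    Tendsto (fun n : ℕ => P {ω | Real.exp (n * (c + ε)) < ‖series ξ F n z ω‖}) atTop (𝓝 0) := by
  refine tendsto_of_tendsto_of_tendsto_of_le_of_le' tendsto_const_nhds
    (tendsto_measure_not_forall_norm_le hident hlog hδ) (.of_forall fun _ => zero_le) ?_
  -- The slack left in the exponent absorbs the constant of the geometric series.
  have hexp : Tendsto (fun n : ℕ => Real.exp (n * (ε / 2 - δ))) atTop atTop :=
    Real.tendsto_exp_atTop.comp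
      (tendsto_natCast_atTop_atTop.atTop_mul_const (by linarith))
  filter_upwards [hF, hexp.eventually_ge_atTop (1 - Real.exp (-δ))⁻¹] with n hn hn'
  refine measure_mono fun ω hω hgood =>
    not_le.2 (show Real.exp (n * (c + ε)) < ‖series ξ F n z ω‖ from hω) ?_
  refine (summable_and_norm_series_le hδ hgood hn).2.trans ?_
  calc _ ≤ Real.exp (δ * n + n * (c + ε / 2)) * Real.exp (n * (ε / 2 - δ)) := by gcongr
    _ = _ := by
      rw [← Real.exp_add]
      congr 1
      ring

theorem isBigO_measureReal_norm_series_lt [IsProbabilityMeasure P]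
    (hmeas : ∀ k, Measurable (ξ k)) (hindep : iIndepFun ξ P)
    (hident : ∀ k, IdentDistrib (ξ k) (ξ 0) P P) (hnondeg : ¬ ∃ a : ℂ, ∀ᵐ ω ∂P, ξ 0 ω = a)
    {F : ℕ → ℕ → ℂ} {z : ℂ} {c ε : ℝ} (hε : 0 < ε)
    (hsum : ∀ᶠ n : ℕ in atTop, ∀ᵐ ω ∂P, Summable (fun k : ℕ => ξ k ω * F k n * z ^ k))
    {l u : ℝ≥0} (hlu : l < u)
    (hF : ∀ᶠ n : ℕ in atTop, ∀ k : ℕ, l * (n : ℝ) ≤ k → (k : ℝ) ≤ u * n →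
      Real.exp (n * (c - ε / 2)) ≤ ‖F k n‖ * ‖z‖ ^ k) :
    (fun n : ℕ => P.real {ω | ‖series ξ F n z ω‖ < Real.exp ((n : ℝ) * (c - ε))})
      =O[atTop] (fun n : ℕ => 1 / √(n : ℝ)) := by
  have hprob : IsProbabilityMeasure (P.map (ξ 0)) :=
    Measure.isProbabilityMeasure_map (hmeas 0).aemeasurable
  obtain ⟨η, hη, hκ⟩ := exists_spread_pos (P.map (ξ 0)) (by
    rintro ⟨a, ha⟩
    exact hnondeg ⟨a, ae_of_ae_map (hmeas 0).aemeasurable ha⟩)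
  set κ := spread (P.map (ξ 0)) η with hκdef
  have hlu' : (0 : ℝ) < u - l := sub_pos.2 (by exact_mod_cast hlu)
  have hexp : Tendsto (fun n : ℕ => Real.exp (n * (ε / 2))) atTop atTop :=
    Real.tendsto_exp_atTop.comp (tendsto_natCast_atTop_atTop.atTop_mul_const (by linarith))
  have hlin : Tendsto (fun n : ℕ => (n : ℝ) * ((u - l) / 2)) atTop atTop :=
    tendsto_natCast_atTop_atTop.atTop_mul_const (by positivity)
  refine Asymptotics.IsBigO.of_bound (3 / √(κ * ((u - l) / 2))) ?_
  -- The gap between `c - ε / 2` and `c - ε` absorbs the factor `4 / η`; half the length `n (u - l)`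
  -- absorbs the rounding loss 1 in counting `J`.
  filter_upwards [hsum, hF, hexp.eventually_ge_atTop (4 / η), hlin.eventually_ge_atTop 1]
    with n hn1 hn2 hn3 hn4
  set J := Finset.Icc ⌈l * (n : ℝ)⌉₊ ⌊u * (n : ℝ)⌋₊ with hJ
  have hcard : (n : ℝ) * ((u - l) / 2) ≤ J.card := by
    have := le_card_Icc_ceil_floor (x := l * (n : ℝ)) (y := u * (n : ℝ)) (by positivity)
    linarith
  have hcard0 : 0 < J.card := by
    have : (0 : ℝ) < J.card := by linarith
    exact_mod_cast this
  have heq (ω : Ω) (k : ℕ) : ξ k ω * F k n * z ^ k = F k n * z ^ k * ξ k ω := by ring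
  have hmain := measureReal_norm_tsum_lt_le P hmeas hindep hident (fun k => F k n * z ^ k)
    (by simpa only [heq] using hn1) J hcard0 (r := Real.exp (n * (c - ε))) (η := η)
    (fun k hk => ?_) hκ
  · simp_rw [← heq] at hmain
    rw [Real.norm_of_nonneg measureReal_nonneg, Real.norm_of_nonneg (by positivity)]
    refine hmain.trans ?_
    have hn0 : (0 : ℝ) < n := by
      by_contra! h
      have : (n : ℝ) * ((u - l) / 2) ≤ 0 := mul_nonpos_of_nonpos_of_nonneg h (by positivity)
      linarith
    calc 3 / √(κ * J.card) ≤ 3 / √(κ * ((n : ℝ) * ((u - l) / 2))) := by gcongr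
      _ = _ := by
        rw [show κ * ((n : ℝ) * ((u - l) / 2)) = κ * ((u - l) / 2) * n by ring,
          Real.sqrt_mul (by positivity)]
        field_simp
  · rw [Finset.mem_Icc, Nat.ceil_le, Nat.le_floor_iff (by positivity)] at hk
    have h1 := hn2 k hk.1 hk.2
    rw [div_le_iff₀ hη] at hn3
    rw [norm_mul, norm_pow]
    calc 4 * Real.exp (n * (c - ε))
        ≤ Real.exp (n * (ε / 2)) * η * Real.exp (n * (c - ε)) := by gcongr
      _ = Real.exp (n * (c - ε / 2)) * η := by
        rw [mul_right_comm, ← Real.exp_add]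
        congr 2
        ring
      _ ≤ _ := by gcongr

theorem tendstoInProbability_logPotential [IsFiniteMeasure P] {F : ℕ → ℕ → ℂ} {z : ℂ} {c : ℝ}
    (hlow : ∀ ε : ℝ, 0 < ε → Tendsto
      (fun n : ℕ => P {ω | ‖series ξ F n z ω‖ < Real.exp (n * (c - ε))}) atTop (𝓝 0))
    (hup : ∀ ε : ℝ, 0 < ε → Tendsto
      (fun n : ℕ => P {ω | Real.exp (n * (c + ε)) < ‖series ξ F n z ω‖}) atTop (𝓝 0)) :
    TendstoInProbability P (fun n => logPotential ξ F n z) c := by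
  intro ε hε
  refine tendsto_of_tendsto_of_tendsto_of_le_of_le' tendsto_const_nhds
    (by simpa using (hlow ε hε).add (hup ε hε)) (.of_forall fun _ => zero_le) ?_
  filter_upwards [eventually_gt_atTop 0] with n hn
  refine (measure_mono fun ω hω => ?_).trans (measure_union_le _ _)
  by_contra h
  simp only [Set.mem_union, Set.mem_ofPred_eq, not_or, not_lt] at h
  exact hω (logPotential_mem_of_norm_series hn h.1 h.2)

end Random

end RandomTaylor

/-! ### Assembly of the two bounds. -/

theorem theorem2p9 {Ω : Type*} [MeasurableSpace Ω] (P : Measure Ω) [IsProbabilityMeasure P]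
    (ξ : ℕ → Ω → ℂ) (hξ_meas : ∀ k, Measurable (ξ k))
    (hξ_indep : iIndepFun ξ P) (hξ_ident : ∀ k, IdentDistrib (ξ k) (ξ 0) P P)
    (hξ_nondeg : ¬ ∃ a : ℂ, ∀ᵐ ω ∂P, ξ 0 ω = a)
    (hξ_log : Integrable (fun ω => Real.log (1 + ‖ξ 0 ω‖)) P)
    (F : ℕ → ℕ → ℂ) (f : ℝ≥0 → ℝ≥0) (T₀ : ℝ≥0∞)
    (hA : RandomTaylor.Assumptions F f T₀)
    (z : ℂ) (hz : ‖z‖ₑ < RandomTaylor.radius f) (hz0 : z ≠ 0) :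
    (∀ᶠ n : ℕ in atTop, ∀ᵐ ω ∂P, Summable (fun k : ℕ => ξ k ω * F k n * z ^ k)) ∧
    ∃ c : ℝ, RandomTaylor.legendreI f (Real.log ‖z‖) = (c : EReal) ∧
      RandomTaylor.TendstoInProbability P
        (fun n => RandomTaylor.logPotential ξ F n z) c ∧
      ∀ ε : ℝ, 0 < ε →
        (fun n : ℕ => P.real {ω | ‖RandomTaylor.series ξ F n z ω‖ <
            Real.exp ((n : ℝ) * (c - ε))})
          =O[atTop] (fun n : ℕ => 1 / Real.sqrt (n : ℝ)) := by
  have hW : 0 < ‖z‖ := norm_pos_iff.2 hz0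
  obtain ⟨r, hzr, hr⟩ := ENNReal.lt_iff_exists_nnreal_btwn.1 hz
  have hWr : ‖z‖ < r := by
    rw [enorm_eq_nnnorm, ENNReal.coe_lt_coe] at hzr
    exact_mod_cast hzr
  obtain ⟨K, hK⟩ := hA.exists_bound hW hWr hr
  obtain ⟨c, hIc, hle, hsup⟩ := RandomTaylor.exists_legendreI_eq_coe hW
    (hA.a1_pos 0 (by simpa using hA.T₀_pos)) hK
  have hsummable : ∀ᶠ n : ℕ in atTop, ∀ᵐ ω ∂P,
      Summable (fun k : ℕ => ξ k ω * F k n * z ^ k) := by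
    obtain ⟨δ, hδ, -, hF⟩ := hA.exists_eventually_coeff_mul_pow_le hW hWr hr hle one_pos
    filter_upwards [hF] with n hn
    filter_upwards [RandomTaylor.ae_exists_forall_norm_le hξ_ident hξ_log hδ] with ω ⟨m, hm⟩
    exact (RandomTaylor.summable_and_norm_series_le hδ hm hn).1
  have hlower : ∀ ε : ℝ, 0 < ε →
      (fun n : ℕ => P.real {ω | ‖RandomTaylor.series ξ F n z ω‖ < Real.exp ((n : ℝ) * (c - ε))})
        =O[atTop] (fun n : ℕ => 1 / Real.sqrt (n : ℝ)) := by
    intro ε hε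
    obtain ⟨l, u, hlu, hF⟩ := hA.exists_eventually_le_coeff_mul_pow hW hsup (half_pos hε)
    exact RandomTaylor.isBigO_measureReal_norm_series_lt hξ_meas hξ_indep hξ_ident hξ_nondeg hε
      hsummable hlu hF
  refine ⟨hsummable, c, hIc,
    RandomTaylor.tendstoInProbability_logPotential (fun ε hε => ?_) (fun ε hε => ?_), hlower⟩
  · have h0 : Tendsto (fun n : ℕ => 1 / Real.sqrt (n : ℝ)) atTop (𝓝 0) := by
      simp_rw [one_div]
      exact (Real.tendsto_sqrt_atTop.comp tendsto_natCast_atTop_atTop).inv_tendsto_atTop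
    simpa using ENNReal.tendsto_ofReal ((hlower ε hε).trans_tendsto h0)
  -- With `ε / 3`, both `2 * δ < ε` and `c + ε / 3 ≤ c + ε / 2` hold.
  · obtain ⟨δ, hδ, hδε, hF⟩ :=
      hA.exists_eventually_coeff_mul_pow_le hW hWr hr hle (show 0 < ε / 3 by positivity)
    refine RandomTaylor.tendsto_measure_lt_norm_series hξ_ident hξ_log hδ (by linarith) ?_
    filter_upwards [hF] with n hn k
    refine (hn k).trans (Real.exp_le_exp.2 ?_)
    have : (0 : ℝ) ≤ n * ε := by positivity
    linarith
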